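/- Let $a<b$ and $0<\alpha<1$, and let $B:[0,1]\to(0,\infty)$ be a normalization function, $B(0)=B(1)=1$. Let $E_\alpha(z)=\sum_{k=0}^\infty \frac{z^k}{\Gamma(\alpha k+1)}$ be the Mittag-Leffler function. For $f\in H^1(a,b)$ (the real Sobolev space of functions in $L^2(a,b)$ whose weak derivative $f'$ is in $L^2(a,b)$), identified with its continuous representative on $[a,b]$, the left Caputo fractional derivative with Mittag-Leffler kernel (ABC derivative) of order $\alpha$ is $$({}^{ABC}{}_aD^\alpha f)(t)=\frac{B(\alpha)}{1-\alpha}\int_a^t E_\alpha\!\left[-\frac{\alpha}{1-\alpha}(t-s)^\alpha\right] f'(s)\,ds,\qquad t\in[a,b].$$ If $f\in H^1(a,b)$ attains its maximum over $[a,b]$ at a point $t_0\in[a,b]$, then the integral defining $({}^{ABC}{}_aD^\alpha f)(t_0)$ converges absolutely and $$({}^{ABC}{}_aD^\alpha f)(t_0)\ \ge\ \frac{B(\alpha)}{1-\alpha}\,E_\alpha\!\left[-\frac{\alpha}{1-\alpha}(t_0-a)^\alpha\right]\bigl(f(t_0)-f(a)\bigr)\ \ge\ 0 .$$ -/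

import Mathlib

open MeasureTheory Set
open scoped ContDiff

/-- The one-parameter Mittag-Leffler function `E_α(z) = ∑ₖ zᵏ / Γ(α k + 1)` at real `z`
(the series converges for every `z` when `0 < α`). -/
noncomputable def mittagLeffler (α z : ℝ) : ℝ :=
  ∑' k : ℕ, z ^ k / Real.Gamma (α * k + 1)

/-- `g` is a weak derivative of `f` on the open interval `(a, b)`. -/
structure IsWeakDeriv (a b : ℝ) (f g : ℝ → ℝ) : Prop where
  locallyIntegrableOn : LocallyIntegrableOn f (Ioo a b)
  locallyIntegrableOn_deriv : LocallyIntegrableOn g (Ioo a b)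
  integral_eq : ∀ φ : ℝ → ℝ, ContDiff ℝ ∞ φ → HasCompactSupport φ → tsupport φ ⊆ Ioo a b →
    ∫ x in Ioo a b, f x * deriv φ x = -∫ x in Ioo a b, g x * φ x

/-- A weak derivative is unique almost everywhere on the interval. -/
theorem IsWeakDeriv.ae_eq {a b : ℝ} {f g h : ℝ → ℝ} (hg : IsWeakDeriv a b f g)
    (hh : IsWeakDeriv a b f h) : g =ᵐ[volume.restrict (Ioo a b)] h := by
  have key : ∀ u : ℝ → ℝ, LocallyIntegrableOn u (Ioo a b) → ∀ φ : ℝ → ℝ, ContDiff ℝ ∞ φ →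
      HasCompactSupport φ → tsupport φ ⊆ Ioo a b →
      Integrable (fun x => φ x * u x) ∧
        ∫ x, φ x * u x = ∫ x in Ioo a b, u x * φ x := by
    intro u hu φ hφ hc hs
    have hz : ∀ x, x ∉ tsupport φ → φ x * u x = 0 := fun x hx => by
      rw [image_eq_zero_of_notMem_tsupport hx, zero_mul]
    constructor
    · have h1 : IntegrableOn u (tsupport φ) := hu.integrableOn_compact_subset hs hc
      have h2 : IntegrableOn (fun x => φ x * u x) (tsupport φ) :=
        h1.continuousOn_mul hφ.continuous.continuousOn hc
      exact (integrableOn_iff_integrable_of_support_subset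
        (fun x hx => by_contra fun hn => hx (hz x hn))).1 h2
    · rw [← setIntegral_eq_integral_of_forall_compl_eq_zero
        (fun x hx => hz x (fun hn => hx (hs hn)))]
      simp only [mul_comm]
  have h0 := isOpen_Ioo.ae_eq_zero_of_integral_contDiff_smul_eq_zero (μ := volume)
    (f := fun x => g x - h x)
    (hg.locallyIntegrableOn_deriv.sub hh.locallyIntegrableOn_deriv) (by
      intro φ hφ hc hs
      obtain ⟨i1, e1⟩ := key g hg.locallyIntegrableOn_deriv φ hφ hc hs
      obtain ⟨i2, e2⟩ := key h hh.locallyIntegrableOn_deriv φ hφ hc hs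
      have e3 := hg.integral_eq φ hφ hc hs
      have e4 := hh.integral_eq φ hφ hc hs
      simp only [smul_eq_mul, mul_sub]
      rw [integral_sub i1 i2, e1, e2]
      linarith)
  rw [Filter.EventuallyEq, ae_restrict_iff' measurableSet_Ioo]
  filter_upwards [h0] with x hx hm
  exact sub_eq_zero.1 (hx hm)

/-- Membership in the Sobolev space `H¹(a, b)`: `f` is square integrable on `(a, b)` and has a
square integrable weak derivative there. -/
def MemH1 (a b : ℝ) (f : ℝ → ℝ) : Prop :=
  MemLp f 2 (volume.restrict (Ioo a b)) ∧
    ∃ g : ℝ → ℝ, IsWeakDeriv a b f g ∧ MemLp g 2 (volume.restrict (Ioo a b))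

open Classical in
/-- The weak derivative of `f` on `(a, b)`: a representative of the almost everywhere class
(`IsWeakDeriv.ae_eq`), and `0` if `f` is not weakly differentiable. -/
noncomputable def weakDeriv (a b : ℝ) (f : ℝ → ℝ) : ℝ → ℝ :=
  if h : ∃ g, IsWeakDeriv a b f g then h.choose else 0

/-- `B` is a normalization function: positive on `[0, 1]` with `B(0) = B(1) = 1`. -/
structure IsNormalization (B : ℝ → ℝ) : Prop where
  pos : ∀ α ∈ Icc (0 : ℝ) 1, 0 < B α
  map_zero : B 0 = 1
  map_one : B 1 = 1

/-- The integrand `s ↦ E_α[-α/(1-α) (t-s)^α] f'(s)` of the ABC derivative at `t`. -/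
noncomputable def abcIntegrand (α a b : ℝ) (f : ℝ → ℝ) (t s : ℝ) : ℝ :=
  mittagLeffler α (-(α / (1 - α)) * (t - s) ^ α) * weakDeriv a b f s

/-- The left Caputo fractional derivative with Mittag-Leffler kernel (ABC derivative) of order
`α`, based at `a`, of a function `f` on `(a, b)`. -/
noncomputable def abcDeriv (B : ℝ → ℝ) (α a b : ℝ) (f : ℝ → ℝ) (t : ℝ) : ℝ :=
  B α / (1 - α) * ∫ s in a..t, abcIntegrand α a b f t s

open Filter Topology

/-! Put `h s = E_α(-λ (t₀ - s)^α)` with `λ = α/(1-α)`. If `h` is positive and increasing on `[a,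
t₀]`, the layer-cake formula and Fubini write `∫ h f' - h(a) ∫ f'` over `[a, t₀]` as an integral
over levels `r = h(c)` of the tails `∫_c^t₀ f' = f(t₀) - f(c)`. These are nonnegative by maximality
of `t₀`. This integrates by parts without differentiating `h`, whose derivative may be singular at
`t₀`.

Positivity and monotonicity of the kernel avoid complete monotonicity. The function `u t = E_α(-λ
t^α)` solves an Abel-Volterra equation with source `1`, and each difference `u t - u (t + d)` solves
the same equation with another source. `pos_of_volterra` gives positivity of both. The tail
identity, `IsWeakDeriv.integral_eq_sub`, rests on the du Bois-Reymond lemma. -/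

/-! ### Convergence and continuity of the Mittag-Leffler series. -/

/-- Cut Euler's integral down to `t > R`, where `t ^ x ≥ R ^ x`. Since `R` is free, Gamma outgrows
every geometric sequence. -/
theorem Real.exp_neg_mul_rpow_le_Gamma {R x : ℝ} (hR : 0 ≤ R) (hx : 0 ≤ x) :
    Real.exp (-R) * R ^ x ≤ Real.Gamma (x + 1) := by
  rw [Real.Gamma_eq_integral (by linarith), ← integral_exp_neg_Ioi R, ← integral_mul_const]
  have hint := Real.GammaIntegral_convergent (s := x + 1) (by linarith)
  have hsub : Ioi R ⊆ Ioi (0 : ℝ) := Ioi_subset_Ioi hR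
  calc ∫ t in Ioi R, Real.exp (-t) * R ^ x
      ≤ ∫ t in Ioi R, Real.exp (-t) * t ^ (x + 1 - 1) := by
        refine setIntegral_mono_on ((integrableOn_exp_neg_Ioi R).mul_const _)
          (hint.mono_set hsub) measurableSet_Ioi fun t ht => ?_
        rw [add_sub_cancel_right]
        gcongr
        exact (mem_Ioi.1 ht).le
    _ ≤ ∫ t in Ioi 0, Real.exp (-t) * t ^ (x + 1 - 1) := by
        refine setIntegral_mono_set hint ?_ hsub.eventuallyLE
        filter_upwards [ae_restrict_mem measurableSet_Ioi] with t ht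
        have : (0 : ℝ) < t := ht
        simp only [Pi.zero_apply]
        positivity

theorem summable_mittagLeffler {α : ℝ} (hα : 0 < α) (z : ℝ) :
    Summable fun k : ℕ => z ^ k / Real.Gamma (α * k + 1) := by
  -- This `R` gives `|z| ≤ R ^ α / 2`, hence a geometric majorant of ratio `1/2`.
  obtain ⟨R, hR, hR0⟩ : ∃ R : ℝ, 2 * (|z| + 1) ≤ R ^ α ∧ 0 < R :=
    (((tendsto_rpow_atTop hα).eventually_ge_atTop _).and (eventually_gt_atTop 0)).exists
  refine Summable.of_norm_bounded (g := fun k : ℕ => Real.exp R * (1 / 2 : ℝ) ^ k)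
    ((summable_geometric_of_lt_one (by norm_num) (by norm_num)).mul_left _) fun k => ?_
  have hG := Real.exp_neg_mul_rpow_le_Gamma hR0.le (x := α * k) (by positivity)
  have hGpos : 0 < Real.Gamma (α * k + 1) := Real.Gamma_pos_of_pos (by positivity)
  rw [norm_div, norm_pow, Real.norm_eq_abs, Real.norm_eq_abs, abs_of_pos hGpos,
    div_le_iff₀ hGpos]
  have h1 : |z| ^ k ≤ (1 / 2 * R ^ α) ^ k :=
    pow_le_pow_left₀ (abs_nonneg z) (by linarith) k
  calc |z| ^ k ≤ (1 / 2 * R ^ α) ^ k := h1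
    _ = Real.exp R * (1 / 2) ^ k * (Real.exp (-R) * R ^ (α * k)) := by
        rw [mul_pow, Real.rpow_mul_natCast hR0.le, Real.exp_neg]
        field_simp
    _ ≤ _ := by gcongr

theorem continuous_mittagLeffler {α : ℝ} (hα : 0 < α) : Continuous (mittagLeffler α) := by
  refine continuous_iff_continuousAt.2 fun z => ?_
  have h : ContinuousOn (mittagLeffler α) (Metric.ball 0 (|z| + 1)) := by
    refine continuousOn_tsum (u := fun k : ℕ => (|z| + 1) ^ k / Real.Gamma (α * k + 1))
      (fun k => by fun_prop) (summable_mittagLeffler hα _) fun k x hx => ?_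
    have hGpos : 0 < Real.Gamma (α * k + 1) := Real.Gamma_pos_of_pos (by positivity)
    rw [mem_ball_zero_iff] at hx
    rw [norm_div, norm_pow, Real.norm_of_nonneg hGpos.le]
    gcongr
  exact h.continuousAt (Metric.isOpen_ball.mem_nhds (by simp))

theorem mittagLeffler_zero (α : ℝ) : mittagLeffler α 0 = 1 := by
  rw [mittagLeffler, tsum_eq_single 0 (fun k hk => by simp [hk])]
  simp

/-! ### The Abel-Volterra equation. -/

/-- The Riemann-Liouville integral of a power function. -/
theorem integral_sub_rpow_mul_rpow {p q t : ℝ} (hp : 0 < p) (hq : 0 < q) (ht : 0 < t) :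
    ∫ s in (0 : ℝ)..t, (t - s) ^ (p - 1) * s ^ (q - 1) =
      t ^ (p + q - 1) * (Real.Gamma p * Real.Gamma q / Real.Gamma (p + q)) := by
  have h := Complex.betaIntegral_scaled (q : ℂ) (p : ℂ) ht
  rw [Complex.betaIntegral_eq_Gamma_mul_div _ _ (by simpa) (by simpa)] at h
  apply Complex.ofReal_injective
  rw [← intervalIntegral.integral_ofReal]
  have e : ∫ s in (0 : ℝ)..t, (((t - s) ^ (p - 1) * s ^ (q - 1) : ℝ) : ℂ) =
      ∫ s in (0 : ℝ)..t, (s : ℂ) ^ ((q : ℂ) - 1) * ((t : ℂ) - s) ^ ((p : ℂ) - 1) := by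
    refine intervalIntegral.integral_congr fun s hs => ?_
    rw [uIcc_of_le ht.le] at hs
    push_cast [Complex.ofReal_cpow hs.1, Complex.ofReal_cpow (sub_nonneg.2 hs.2)]
    ring
  rw [e, h, ← Complex.ofReal_add, Complex.Gamma_ofReal, Complex.Gamma_ofReal,
    Complex.Gamma_ofReal]
  push_cast [Complex.ofReal_cpow ht.le]
  rw [add_comm (q : ℂ) p, mul_comm (Real.Gamma q : ℂ), add_comm q p]

theorem intervalIntegrable_sub_rpow {α : ℝ} (hα : 0 < α) (t a b : ℝ) :
    IntervalIntegrable (fun s => (t - s) ^ (α - 1)) volume a b := by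
  simpa using (intervalIntegral.intervalIntegrable_rpow' (a := t - a) (b := t - b)
    (r := α - 1) (by linarith)).comp_sub_left t

theorem continuous_mittagLeffler_neg_rpow {α : ℝ} (hα : 0 < α) (lam : ℝ) :
    Continuous fun t : ℝ => mittagLeffler α (-lam * t ^ α) :=
  (continuous_mittagLeffler hα).comp
    (continuous_const.mul (Real.continuous_rpow_const hα.le))

/-- `t ↦ E_α(-λ t^α)` solves a linear Volterra equation with Abel kernel. -/
theorem mittagLeffler_volterra {α lam t : ℝ} (hα : 0 < α) (hlam : 0 ≤ lam) (ht : 0 < t) :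
    mittagLeffler α (-lam * t ^ α) + lam / Real.Gamma α *
      ∫ s in (0 : ℝ)..t, (t - s) ^ (α - 1) * mittagLeffler α (-lam * s ^ α) = 1 := by
  have hΓ := Real.Gamma_pos_of_pos hα
  have hterm : ∀ (k : ℕ) {s : ℝ}, 0 ≤ s → (s ^ α) ^ k = s ^ (α * k + 1 - 1) := fun k s hs => by
    rw [add_sub_cancel_right, Real.rpow_mul_natCast hs]
  have hG : ∀ k : ℕ, 0 < Real.Gamma (α * k + 1) := fun k => Real.Gamma_pos_of_pos (by positivity)
  have hsum : HasSum (fun k : ℕ => ∫ s in (0 : ℝ)..t,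
      (t - s) ^ (α - 1) * ((-lam * s ^ α) ^ k / Real.Gamma (α * k + 1)))
      (∫ s in (0 : ℝ)..t, (t - s) ^ (α - 1) * mittagLeffler α (-lam * s ^ α)) := by
    refine intervalIntegral.hasSum_integral_of_dominated_convergence
      (fun k s => (t - s) ^ (α - 1) * ((lam * t ^ α) ^ k / Real.Gamma (α * k + 1)))
      (fun k => ?_) (fun k => ae_of_all _ fun s hs => ?_)
      (ae_of_all _ fun s hs => (summable_mittagLeffler hα _).mul_left _) ?_
      (ae_of_all _ fun s hs => (summable_mittagLeffler hα _).hasSum.mul_left _)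
    · refine AEStronglyMeasurable.mul ?_ ?_
      · exact (intervalIntegrable_sub_rpow hα t 0 t).def'.aestronglyMeasurable
      · refine Continuous.aestronglyMeasurable ?_
        have := Real.continuous_rpow_const hα.le
        fun_prop
    · rw [uIoc_of_le ht.le] at hs
      have h0 : 0 ≤ t - s := sub_nonneg.2 hs.2
      have h1 : 0 ≤ s := hs.1.le
      rw [norm_mul, norm_div, norm_pow, norm_mul, norm_neg, Real.norm_of_nonneg hlam,
        Real.norm_of_nonneg (hG k).le, Real.norm_of_nonneg (Real.rpow_nonneg h0 _),
        Real.norm_of_nonneg (Real.rpow_nonneg h1 _)]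
      have := hG k
      gcongr
      exact hs.2
    · simp_rw [tsum_mul_left]
      exact (intervalIntegrable_sub_rpow hα t 0 t).mul_const _
  -- The Abel integral sends the `k`-th term of the series to minus the next one, so in the sum only
  -- the term `k = 0`, equal to `1`, survives.
  have hval : ∀ k : ℕ, lam / Real.Gamma α * ∫ s in (0 : ℝ)..t,
      (t - s) ^ (α - 1) * ((-lam * s ^ α) ^ k / Real.Gamma (α * k + 1)) =
      -((-lam * t ^ α) ^ (k + 1) / Real.Gamma (α * (k + 1 : ℕ) + 1)) := fun k => by
    have e : ∫ s in (0 : ℝ)..t,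
        (t - s) ^ (α - 1) * ((-lam * s ^ α) ^ k / Real.Gamma (α * k + 1)) =
        ∫ s in (0 : ℝ)..t,
          ((-lam) ^ k / Real.Gamma (α * k + 1)) * ((t - s) ^ (α - 1) * s ^ (α * k + 1 - 1)) := by
      refine intervalIntegral.integral_congr fun s hs => ?_
      rw [uIcc_of_le ht.le] at hs
      simp only [mul_pow, hterm k hs.1]
      ring
    have h1 : α + (α * k + 1) = α * (k + 1 : ℕ) + 1 := by push_cast; ring
    rw [e, intervalIntegral.integral_const_mul,
      integral_sub_rpow_mul_rpow hα (by positivity) ht, h1, mul_pow, hterm _ ht.le, pow_succ]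
    have := (hG k).ne'
    have := (hG (k + 1)).ne'
    field_simp
  have hE := (summable_mittagLeffler hα (-lam * t ^ α)).hasSum
  have h1 := (hasSum_nat_add_iff' 1).2 hE
  have h2 := (hsum.mul_left (lam / Real.Gamma α))
  simp_rw [hval] at h2
  have h3 := h2.unique h1.neg
  rw [h3]
  simp [mittagLeffler]

/-! ### Positivity and monotonicity of the kernel. -/

theorem intervalIntegrable_sub_rpow_mul {α : ℝ} (hα : 0 < α) {v : ℝ → ℝ} (hv : Continuous v)
    (t a b : ℝ) : IntervalIntegrable (fun s => (t - s) ^ (α - 1) * v s) volume a b :=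
  (intervalIntegrable_sub_rpow hα t a b).mul_continuousOn hv.continuousOn

theorem integral_sub_rpow_self {α : ℝ} (hα : 0 < α) (t T : ℝ) :
    ∫ s in t..T, (T - s) ^ (α - 1) = (T - t) ^ α / α := by
  rw [intervalIntegral.integral_comp_sub_left (fun x => x ^ (α - 1)) T, sub_self,
    integral_rpow (Or.inl (by linarith))]
  simp [Real.zero_rpow hα.ne']

/-- For `0 ≤ s < t ≤ T` one has `(T - s)/(t - s) ≥ T/t`, and the exponent `α - 1 ≤ 0` reverses this.
-/
theorem sub_rpow_le_div_rpow_mul {α s t T : ℝ} (hα : α ≤ 1) (hs : 0 ≤ s) (hst : s < t)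
    (htT : t ≤ T) : (T - s) ^ (α - 1) ≤ (T / t) ^ (α - 1) * (t - s) ^ (α - 1) := by
  have ht : 0 < t := hs.trans_lt hst
  have h1 : 0 < t - s := sub_pos.2 hst
  have hT : 0 < T := ht.trans_le htT
  rw [← Real.mul_rpow (by positivity) h1.le]
  refine Real.rpow_le_rpow_of_nonpos (by positivity) ?_ (by linarith)
  rw [div_mul_eq_mul_div, div_le_iff₀ ht]
  nlinarith

/-- Positivity for linear Volterra equations with Abel kernel: the source `g` may decay at most
as fast as the kernel. -/
theorem pos_of_volterra {α c : ℝ} (hα0 : 0 < α) (hα1 : α < 1) (hc : 0 ≤ c) {v g : ℝ → ℝ}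
    (hv : Continuous v) (hv0 : 0 < v 0)
    (heq : ∀ t, 0 < t → v t + c * ∫ s in (0 : ℝ)..t, (t - s) ^ (α - 1) * v s = g t)
    (hg : ∀ t T, 0 < t → t ≤ T → (T / t) ^ (α - 1) * g t ≤ g T) {t : ℝ} (ht : 0 ≤ t) :
    0 < v t := by
  by_contra! hneg
  -- Let `T = sInf S` be the first point where `v ≤ 0`. The equation at `T` will be compared with
  -- `ρ` times the equation at a maximum point `m` of `v` just before `T`.
  set S : Set ℝ := Ici 0 ∩ v ⁻¹' Iic 0 with hS
  have hSc : IsClosed S := isClosed_Ici.inter (isClosed_Iic.preimage hv)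
  have hSb : BddBelow S := ⟨0, fun x hx => hx.1⟩
  have hTS : sInf S ∈ S := hSc.csInf_mem ⟨t, ht, hneg⟩ hSb
  set T := sInf S with hT
  have hT0 : 0 < T := lt_of_le_of_ne hTS.1 fun h => by
    have h2 : v T ≤ 0 := hTS.2
    rw [← h] at h2
    linarith
  have hpos : ∀ s, 0 ≤ s → s < T → 0 < v s := fun s hs hsT => by
    by_contra! h
    exact absurd (csInf_le hSb ⟨hs, h⟩) (not_le.2 hsT)
  have hlim : Tendsto (fun x => c * ((T - x) ^ α / α)) (𝓝[<] T) (𝓝 0) := by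
    have : Continuous fun x => c * ((T - x) ^ α / α) := by
      have := Real.continuous_rpow_const hα0.le
      fun_prop
    have h := this.tendsto T
    simp only [sub_self, Real.zero_rpow hα0.ne', zero_div, mul_zero] at h
    exact h.mono_left nhdsWithin_le_nhds
  -- The first condition makes the Abel kernel on `[m, T]` contribute less than `v m / 2`; the
  -- second gives `ρ ≥ 1/2`. Together they yield the contradiction `ρ * v m < v m / 2`.
  obtain ⟨τ, ⟨hτ1, hτ2⟩, hτT⟩ : ∃ x, (c * ((T - x) ^ α / α) < 1 / 2 ∧ T / 2 < x) ∧ x < T :=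
    (((hlim.eventually_lt_const (by norm_num)).and
      (mem_nhdsWithin_of_mem_nhds (Ioi_mem_nhds (by linarith)))).and
      self_mem_nhdsWithin).exists
  obtain ⟨m, hm, hmax⟩ := isCompact_Icc.exists_isMaxOn (nonempty_Icc.2 hτT.le)
    hv.continuousOn (s := Icc τ T)
  have hvm : 0 < v m := (hpos τ (by linarith) hτT).trans_le (hmax (left_mem_Icc.2 hτT.le))
  have hmT : m < T := lt_of_le_of_ne hm.2 fun h => by
    have h2 : v T ≤ 0 := hTS.2
    rw [← h] at h2
    linarith
  have hm0 : 0 < m := by linarith [hm.1]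
  set ρ := (T / m) ^ (α - 1) with hρ
  have hρ2 : 1 / 2 ≤ ρ := by
    rw [hρ, ← inv_div m T, Real.inv_rpow (by positivity), ← Real.rpow_neg (by positivity)]
    calc (1 / 2 : ℝ) ≤ m / T := by rw [le_div_iff₀ hT0]; linarith [hm.1]
      _ = (m / T) ^ (1 : ℝ) := (Real.rpow_one _).symm
      _ ≤ (m / T) ^ (-(α - 1)) := Real.rpow_le_rpow_of_exponent_ge (by positivity)
          ((div_le_one hT0).2 hm.2) (by linarith)
  have hI := intervalIntegrable_sub_rpow_mul hα0 hv
  have h1 : ∫ s in (0 : ℝ)..m, (T - s) ^ (α - 1) * v s ≤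
      ρ * ∫ s in (0 : ℝ)..m, (m - s) ^ (α - 1) * v s := by
    rw [← intervalIntegral.integral_const_mul]
    refine intervalIntegral.integral_mono_on_of_le_Ioo hm0.le (hI T 0 m)
      ((hI m 0 m).const_mul _) fun s hs => ?_
    rw [← mul_assoc]
    exact mul_le_mul_of_nonneg_right (sub_rpow_le_div_rpow_mul hα1.le hs.1.le hs.2 hm.2)
      (hpos s hs.1.le (hs.2.trans hmT)).le
  have h2 : ∫ s in m..T, (T - s) ^ (α - 1) * v s ≤ (T - m) ^ α / α * v m := by
    rw [← integral_sub_rpow_self hα0, ← intervalIntegral.integral_mul_const]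
    refine intervalIntegral.integral_mono_on hm.2 (hI T m T)
      ((intervalIntegrable_sub_rpow hα0 T m T).mul_const _) fun s hs => ?_
    exact mul_le_mul_of_nonneg_left (hmax ⟨hm.1.trans hs.1, hs.2⟩)
      (Real.rpow_nonneg (sub_nonneg.2 hs.2) _)
  have h3 : (T - m) ^ α / α ≤ (T - τ) ^ α / α := by
    have := sub_nonneg.2 hm.2
    gcongr
    exact hm.1
  have hsplit := intervalIntegral.integral_add_adjacent_intervals (hI T 0 m) (hI T m T)
  have eT := heq T hT0
  have em := heq m hm0
  have hgm := hg m T hm0 hm.2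
  have hvT : v T ≤ 0 := hTS.2
  rw [← hsplit] at eT
  have k1 := mul_le_mul_of_nonneg_left h1 hc
  have k2 := mul_le_mul_of_nonneg_left h2 hc
  have k3 : c * ((T - m) ^ α / α) * v m < 1 / 2 * v m :=
    mul_lt_mul_of_pos_right ((mul_le_mul_of_nonneg_left h3 hc).trans_lt hτ1) hvm
  have k4 : ρ * g m = ρ * v m + c * (ρ * ∫ s in (0 : ℝ)..m, (m - s) ^ (α - 1) * v s) := by
    rw [← em]; ring
  have k5 := mul_le_mul_of_nonneg_right hρ2 hvm.le
  linarith

theorem mittagLeffler_neg_rpow_pos {α lam t : ℝ} (hα0 : 0 < α) (hα1 : α < 1) (hlam : 0 ≤ lam)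
    (ht : 0 ≤ t) : 0 < mittagLeffler α (-lam * t ^ α) := by
  refine pos_of_volterra (v := fun t => mittagLeffler α (-lam * t ^ α)) hα0 hα1
    (div_nonneg hlam (Real.Gamma_pos_of_pos hα0).le)
    (continuous_mittagLeffler_neg_rpow hα0 lam) ?_
    (fun t ht => mittagLeffler_volterra hα0 hlam ht) (fun t T ht htT => ?_) ht
  · simp [Real.zero_rpow hα0.ne', mittagLeffler_zero]
  · rw [mul_one]
    exact Real.rpow_le_one_of_one_le_of_nonpos ((one_le_div ht).2 htT) (by linarith)

/-- Subtracting the equations at `t` and `t + d` leaves the same equation for `u t - u (t + d)`,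
with the history over `[0, d]` as source. That source decays no faster than the kernel, because `u >
0`. -/
theorem mittagLeffler_neg_rpow_strictAntiOn {α lam : ℝ} (hα0 : 0 < α) (hα1 : α < 1)
    (hlam : 0 < lam) : StrictAntiOn (fun t : ℝ => mittagLeffler α (-lam * t ^ α)) (Ici 0) := by
  intro x hx y _ hxy
  set u : ℝ → ℝ := fun t => mittagLeffler α (-lam * t ^ α) with hu
  have huc : Continuous u := continuous_mittagLeffler_neg_rpow hα0 lam
  have hupos : ∀ t, 0 ≤ t → 0 < u t := fun t ht => mittagLeffler_neg_rpow_pos hα0 hα1 hlam.le ht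
  set c := lam / Real.Gamma α with hcdef
  have hc : 0 < c := div_pos hlam (Real.Gamma_pos_of_pos hα0)
  have hvolt : ∀ t, 0 < t → u t + c * ∫ s in (0 : ℝ)..t, (t - s) ^ (α - 1) * u s = 1 :=
    fun t ht => mittagLeffler_volterra hα0 hlam.le ht
  have hI := intervalIntegrable_sub_rpow_mul hα0 huc
  set d := y - x with hd
  have hd0 : 0 < d := sub_pos.2 hxy
  suffices h : 0 < u x - u (x + d) by
    rw [hd, add_sub_cancel] at h
    exact sub_pos.1 h
  refine pos_of_volterra (v := fun t => u t - u (t + d))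
    (g := fun t => c * ∫ s in (0 : ℝ)..d, (t + d - s) ^ (α - 1) * u s) hα0 hα1 hc.le
    (by fun_prop) ?_ (fun t ht => ?_) (fun t T ht htT => ?_) (mem_Ici.1 hx)
  · have h0 : u 0 = 1 := by simp [hu, Real.zero_rpow hα0.ne', mittagLeffler_zero]
    have hp : 0 < ∫ s in (0 : ℝ)..d, (d - s) ^ (α - 1) * u s :=
      intervalIntegral.intervalIntegral_pos_of_pos_on (hI d 0 d)
        (fun s hs => mul_pos (Real.rpow_pos_of_pos (sub_pos.2 hs.2) _) (hupos s hs.1.le)) hd0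
    have := hvolt d hd0
    have := mul_pos hc hp
    simp only [zero_add]
    linarith
  · have huc' : Continuous fun s => u (s + d) := by fun_prop
    have e1 := hvolt t ht
    have e2 := hvolt (t + d) (by linarith)
    have e3 : ∫ s in d..(t + d), (t + d - s) ^ (α - 1) * u s =
        ∫ s in (0 : ℝ)..t, (t - s) ^ (α - 1) * u (s + d) := by
      have := intervalIntegral.integral_comp_add_right (a := 0) (b := t)
        (fun s => (t + d - s) ^ (α - 1) * u s) d
      rw [zero_add] at this
      rw [← this]
      simp only [add_sub_add_right_eq_sub]
    rw [← intervalIntegral.integral_add_adjacent_intervals (hI (t + d) 0 d) (hI (t + d) d (t + d)),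
      e3] at e2
    have e4 : ∫ s in (0 : ℝ)..t, (t - s) ^ (α - 1) * (u s - u (s + d)) =
        (∫ s in (0 : ℝ)..t, (t - s) ^ (α - 1) * u s) -
          ∫ s in (0 : ℝ)..t, (t - s) ^ (α - 1) * u (s + d) := by
      rw [← intervalIntegral.integral_sub (hI t 0 t)
        (intervalIntegrable_sub_rpow_mul hα0 huc' t 0 t)]
      simp only [mul_sub]
    rw [e4]
    linarith
  · rw [mul_left_comm, ← intervalIntegral.integral_const_mul]
    refine mul_le_mul_of_nonneg_left ?_ hc.le
    refine intervalIntegral.integral_mono_on hd0.le ((hI (t + d) 0 d).const_mul _)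
      (hI (T + d) 0 d) fun s hs => ?_
    rw [← mul_assoc]
    refine mul_le_mul_of_nonneg_right ?_ (hupos s hs.1).le
    have h1 : 0 ≤ d - s := sub_nonneg.2 hs.2
    have hT : 0 < T := ht.trans_le htT
    rw [← Real.mul_rpow (by positivity) (by linarith)]
    refine Real.rpow_le_rpow_of_nonpos (by linarith) ?_ (by linarith)
    rw [div_mul_eq_mul_div, le_div_iff₀ ht]
    nlinarith

/-! ### Weak derivatives and the fundamental theorem of calculus. -/

/-- **du Bois-Reymond lemma**: a continuous function on an interval which is orthogonal to the
derivatives of all test functions is constant. -/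
theorem eqOn_const_of_integral_mul_deriv_eq_zero {a b : ℝ} (hab : a < b) {w : ℝ → ℝ}
    (hw : Continuous w)
    (h : ∀ φ : ℝ → ℝ, ContDiff ℝ ∞ φ → HasCompactSupport φ → tsupport φ ⊆ Ioo a b →
      ∫ x, w x * deriv φ x = 0) : ∃ C, EqOn w (fun _ => C) (Icc a b) := by
  let η : ContDiffBump ((a + b) / 2) :=
    ⟨(b - a) / 8, (b - a) / 4, by linarith, by linarith⟩
  set ψ₀ := η.normed volume with hψ₀
  have hψ₀s : ContDiff ℝ ∞ ψ₀ := η.contDiff_normed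
  have hψ₀c : HasCompactSupport ψ₀ := η.hasCompactSupport_normed
  have hψ₀t : tsupport ψ₀ = Metric.closedBall ((a + b) / 2) ((b - a) / 4) :=
    η.tsupport_normed_eq
  have hψ₀i : ∫ x, ψ₀ x = 1 := η.integral_normed
  refine ⟨∫ x, w x * ψ₀ x, ?_⟩
  refine Measure.eqOn_Icc_of_ae_eq (μ := volume) hab.ne ?_ hw.continuousOn continuousOn_const
  have h0 := isOpen_Ioo.ae_eq_zero_of_integral_contDiff_smul_eq_zero (μ := volume)
    (U := Ioo a b) (f := fun x => w x - ∫ x, w x * ψ₀ x)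
    ((hw.sub continuous_const).locallyIntegrable.locallyIntegrableOn _) ?_
  · rw [← restrict_Ioo_eq_restrict_Icc, EventuallyEq, ae_restrict_iff' measurableSet_Ioo]
    filter_upwards [h0] with x hx hm using sub_eq_zero.1 (hx hm)
  intro ψ hψ hψc hψt
  -- Removing the mean of `ψ` lets the primitive of `χ` vanish outside the hull of `K`, so it is an
  -- admissible test function.
  set χ : ℝ → ℝ := fun x => ψ x - (∫ y, ψ y) * ψ₀ x with hχ
  have hχs : ContDiff ℝ ∞ χ := hψ.sub (contDiff_const.mul hψ₀s)
  have hψi : Integrable ψ := hψ.continuous.integrable_of_hasCompactSupport hψc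
  have hψ₀int : Integrable ψ₀ := hψ₀s.continuous.integrable_of_hasCompactSupport hψ₀c
  have hχi : ∫ x, χ x = 0 := by
    rw [hχ, integral_sub hψi (hψ₀int.const_mul _), integral_const_mul, hψ₀i, mul_one, sub_self]
  set K := tsupport ψ ∪ tsupport ψ₀ with hK
  have hKc : IsCompact K := hψc.isCompact.union hψ₀c.isCompact
  have hKn : K.Nonempty := ⟨(a + b) / 2, Or.inr (by
    rw [hψ₀t]; exact Metric.mem_closedBall_self (by linarith))⟩
  have hKab : K ⊆ Ioo a b := union_subset hψt (by
    rw [hψ₀t, Real.closedBall_eq_Icc]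
    exact fun x hx => ⟨by linarith [hx.1], by linarith [hx.2]⟩)
  have hc := hKab (hKc.sInf_mem hKn)
  have hd := hKab (hKc.sSup_mem hKn)
  have hχK : ∀ x, x ∉ K → χ x = 0 := fun x hx => by
    have h1 : ψ x = 0 := image_eq_zero_of_notMem_tsupport fun hh => hx (Or.inl hh)
    have h2 : ψ₀ x = 0 := image_eq_zero_of_notMem_tsupport fun hh => hx (Or.inr hh)
    simp [hχ, h1, h2]
  set φ : ℝ → ℝ := fun x => ∫ y in a..x, χ y with hφ
  have hφd : deriv φ = χ := funext fun x => hχs.continuous.deriv_integral _ a x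
  have hφs : ContDiff ℝ ∞ φ := by
    rw [contDiff_infty_iff_deriv, hφd]
    exact ⟨fun x => (hχs.continuous.integral_hasStrictDerivAt a x).hasDerivAt.differentiableAt,
      hχs⟩
  have hφsupp : Function.support φ ⊆ Icc (sInf K) (sSup K) := by
    intro x hx
    by_contra hxn
    rw [mem_Icc, not_and_or, not_le, not_le] at hxn
    refine hx ?_
    rcases hxn with hxn | hxn
    · refine intervalIntegral.integral_zero_ae (ae_of_all _ fun y hy => hχK y fun hyK => ?_)
      have h1 := csInf_le hKc.bddBelow hyK
      have h2 := hy.2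
      rcases le_max_iff.1 h2 with h3 | h3
      · linarith [hc.1]
      · linarith
    · rw [hφ, ← hχi]
      refine intervalIntegral.integral_eq_integral_of_support_subset fun y hy => ?_
      have hyK : y ∈ K := by_contra fun hn => hy (hχK y hn)
      exact ⟨(hKab hyK).1, (le_csSup hKc.bddAbove hyK).trans hxn.le⟩
  have key := h φ hφs (HasCompactSupport.of_support_subset_isCompact isCompact_Icc hφsupp)
    ((closure_minimal hφsupp isClosed_Icc).trans fun x hx =>
      ⟨hc.1.trans_le hx.1, hx.2.trans_lt hd.2⟩)
  rw [hφd] at key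
  have i1 : Integrable fun x => w x * ψ x :=
    (hw.mul hψ.continuous).integrable_of_hasCompactSupport hψc.mul_left
  have i2 : Integrable fun x => w x * ψ₀ x :=
    (hw.mul hψ₀s.continuous).integrable_of_hasCompactSupport hψ₀c.mul_left
  have e1 : ∫ x, w x * χ x = (∫ x, w x * ψ x) - (∫ y, ψ y) * ∫ x, w x * ψ₀ x := by
    rw [← integral_const_mul, ← integral_sub i1 (i2.const_mul _)]
    congr 1 with x
    simp only [hχ]
    ring
  have e2 : ∫ x, ψ x • (w x - ∫ x, w x * ψ₀ x) =
      (∫ x, w x * ψ x) - (∫ y, ψ y) * ∫ x, w x * ψ₀ x := by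
    rw [← integral_mul_const, ← integral_sub i1 (hψi.mul_const _)]
    congr 1 with x
    simp only [smul_eq_mul]
    ring
  rw [e2, ← e1, key]

/-- The fundamental theorem of calculus for the continuous representative of a function with
integrable weak derivative. -/
theorem IsWeakDeriv.integral_eq_sub {a b : ℝ} (hab : a < b) {f g : ℝ → ℝ}
    (hfg : IsWeakDeriv a b f g) (hf : ContinuousOn f (Icc a b))
    (hg : IntervalIntegrable g volume a b) {x y : ℝ} (hx : x ∈ Icc a b) (hy : y ∈ Icc a b) :
    ∫ s in x..y, g s = f y - f x := by
  set G : ℝ → ℝ := fun x => ∫ s in a..x, g s with hG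
  have hGac : AbsolutelyContinuousOnInterval G a b :=
    hg.absolutelyContinuousOnInterval_intervalIntegral (by simp)
  have hGc : ContinuousOn G (Icc a b) := by
    simpa [uIcc_of_le hab.le] using hGac.continuousOn
  have hGd : ∀ᵐ x, x ∈ uIcc a b → HasDerivAt G (g x) x := by
    filter_upwards [hg.ae_hasDerivAt_integral] with x hx hxm using hx hxm a (by simp)
  -- Extending `f - G` by its endpoint values makes it continuous on the whole line; only its values
  -- on `[a, b]` matter.
  set w : ℝ → ℝ := IccExtend hab.le ((Icc a b).domRestrict (fun x => f x - G x)) with hw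
  have hwc : Continuous w := (hf.sub hGc).domRestrict.Icc_extend'
  have hwe : ∀ x ∈ Icc a b, w x = f x - G x := fun x hx => by
    rw [hw, IccExtend_of_mem hab.le _ hx]; rfl
  have hzero : ∀ φ : ℝ → ℝ, ContDiff ℝ ∞ φ → HasCompactSupport φ → tsupport φ ⊆ Ioo a b →
      ∫ x, w x * deriv φ x = 0 := by
    intro φ hφ hφc hφt
    have hφ' : Continuous (deriv φ) := hφ.continuous_deriv (by simp)
    have hz : ∀ x, x ∉ Ioo a b → φ x = 0 := fun x hx =>
      image_eq_zero_of_notMem_tsupport fun hh => hx (hφt hh)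
    have hz' : ∀ x, x ∉ Ioo a b → w x * deriv φ x = 0 := fun x hx => by
      rw [image_eq_zero_of_notMem_tsupport fun hh => hx (hφt (tsupport_deriv_subset hh)), mul_zero]
    rw [← setIntegral_eq_integral_of_forall_compl_eq_zero hz']
    have i1 : IntegrableOn (fun x => f x * deriv φ x) (Ioo a b) :=
      ((hf.mul hφ'.continuousOn).integrableOn_Icc).mono_set Ioo_subset_Icc_self
    have i2 : IntegrableOn (fun x => G x * deriv φ x) (Ioo a b) :=
      ((hGc.mul hφ'.continuousOn).integrableOn_Icc).mono_set Ioo_subset_Icc_self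
    have e1 : ∫ x in Ioo a b, w x * deriv φ x =
        (∫ x in Ioo a b, f x * deriv φ x) - ∫ x in Ioo a b, G x * deriv φ x := by
      rw [← integral_sub i1 i2]
      refine setIntegral_congr_fun measurableSet_Ioo fun x hx => ?_
      simp only [hwe x (Ioo_subset_Icc_self hx)]
      ring
    have e2 : ∫ x in Ioo a b, G x * deriv φ x = -∫ x in Ioo a b, g x * φ x := by
      have hφac : AbsolutelyContinuousOnInterval φ a b :=
        (hφ.of_le (by norm_cast)).contDiffOn.absolutelyContinuousOnInterval
      have hp := hGac.integral_mul_deriv_eq_deriv_mul hφac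
      rw [hz a (by simp), hz b (by simp), mul_zero, mul_zero, sub_self, zero_sub] at hp
      rw [← integral_Ioc_eq_integral_Ioo, ← integral_Ioc_eq_integral_Ioo,
        ← intervalIntegral.integral_of_le hab.le, ← intervalIntegral.integral_of_le hab.le, hp]
      congr 1
      refine intervalIntegral.integral_congr_ae ?_
      filter_upwards [hGd] with x hx hxm
      rw [(hx (uIoc_subset_uIcc hxm)).deriv]
    rw [e1, e2, hfg.integral_eq φ hφ hφc hφt, sub_self]
  obtain ⟨C, hC⟩ := eqOn_const_of_integral_mul_deriv_eq_zero hab hwc hzero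
  have ex := hC hx
  have ey := hC hy
  simp only [hwe x hx, hwe y hy, hG] at ex ey
  have hsub : ∀ z ∈ Icc a b, IntervalIntegrable g volume a z := fun z hz =>
    hg.mono_set (by
      rw [uIcc_of_le hab.le, uIcc_of_le hz.1]
      exact Icc_subset_Icc_right hz.2)
  rw [← intervalIntegral.integral_interval_sub_left (hsub y hy) (hsub x hx)]
  linarith

/-! ### Layer-cake inequality. -/

/-- A lower bound in the spirit of the second mean value theorem for integrals. -/
theorem mul_integral_le_integral_mul_of_strictMonoOn {a T : ℝ} (haT : a ≤ T) {h g : ℝ → ℝ}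
    (hc : Continuous h) (hm : StrictMonoOn h (Icc a T)) (hg : IntervalIntegrable g volume a T)
    (hpos : ∀ c ∈ Icc a T, 0 ≤ ∫ s in c..T, g s) :
    h a * ∫ s in a..T, g s ≤ ∫ s in a..T, h s * g s := by
  have hgi : IntegrableOn g (Ioc a T) := (intervalIntegrable_iff_integrableOn_Ioc_of_le haT).1 hg
  have hhT : h a ≤ h T := hm.monotoneOn (left_mem_Icc.2 haT) (right_mem_Icc.2 haT) haT
  -- For fixed `s`, the levels `r` in `(h a, h T]` below `h s` have total length `h s - h a`.
  set S : Set (ℝ × ℝ) := {p | p.2 < h p.1} with hS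
  have hSm : MeasurableSet S := (isOpen_lt continuous_snd (hc.comp continuous_fst)).measurableSet
  set F : ℝ → ℝ → ℝ := fun s r => S.indicator (fun p => g p.1) (s, r) with hF
  have hFi : Integrable (Function.uncurry F)
      ((volume.restrict (Ioc a T)).prod (volume.restrict (Ioc (h a) (h T)))) :=
    (hgi.comp_fst _).indicator hSm
  have hswap := integral_integral_swap hFi
  have hleft : ∫ s in Ioc a T, ∫ r in Ioc (h a) (h T), F s r =
      (∫ s in a..T, h s * g s) - h a * ∫ s in a..T, g s := by
    rw [← intervalIntegral.integral_const_mul, ← intervalIntegral.integral_sub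
      (hg.continuousOn_mul hc.continuousOn) (hg.const_mul _),
      intervalIntegral.integral_of_le haT]
    refine setIntegral_congr_fun measurableSet_Ioc fun s hs => ?_
    have hs' : s ∈ Icc a T := Ioc_subset_Icc_self hs
    have h1 : h a ≤ h s := hm.monotoneOn (left_mem_Icc.2 haT) hs' hs'.1
    have h2 : h s ≤ h T := hm.monotoneOn hs' (right_mem_Icc.2 haT) hs'.2
    have e : F s = (Iio (h s)).indicator fun _ => g s := by
      ext r
      simp [hF, hS, indicator]
    simp only [e]
    rw [setIntegral_indicator measurableSet_Iio]
    have e2 : (Ioc (h a) (h T) ∩ Iio (h s) : Set ℝ) =ᵐ[volume] Ioc (h a) (h s) := by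
      have : Ioo (h a) (h s) = Ioc (h a) (h T) ∩ Iio (h s) := by
        ext r
        simp only [mem_Ioo, mem_inter_iff, mem_Ioc, mem_Iio]
        constructor
        · rintro ⟨h3, h4⟩; exact ⟨⟨h3, by linarith⟩, h4⟩
        · rintro ⟨⟨h3, _⟩, h4⟩; exact ⟨h3, h4⟩
      rw [← this]
      exact Ioo_ae_eq_Ioc
    rw [setIntegral_congr_set e2, setIntegral_const, Real.volume_real_Ioc_of_le h1, smul_eq_mul]
    ring
  have hright : 0 ≤ ∫ r in Ioc (h a) (h T), ∫ s in Ioc a T, F s r := by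
    refine setIntegral_nonneg measurableSet_Ioc fun r hr => ?_
    -- Every level is some `h c`; strict monotonicity makes its superlevel set exactly `(c, T]`.
    obtain ⟨c, hcm, rfl⟩ := intermediate_value_Icc haT hc.continuousOn (Ioc_subset_Icc_self hr)
    have e : ∀ s ∈ Ioc a T, F s (h c) = (Ioc c T).indicator g s := fun s hs => by
      have : h c < h s ↔ c < s := hm.lt_iff_lt hcm (Ioc_subset_Icc_self hs)
      simp [hF, hS, indicator, this, hs.2]
    rw [setIntegral_congr_fun measurableSet_Ioc e, setIntegral_indicator measurableSet_Ioc,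
      inter_eq_self_of_subset_right (Ioc_subset_Ioc_left hcm.1),
      ← intervalIntegral.integral_of_le hcm.2]
    exact hpos c hcm
  linarith

/-! ### The extremum inequality. -/

theorem MemH1.isWeakDeriv_weakDeriv {a b : ℝ} {f : ℝ → ℝ} (hf : MemH1 a b f) :
    IsWeakDeriv a b f (weakDeriv a b f) := by
  obtain ⟨-, g, hg, -⟩ := hf
  have h : ∃ g, IsWeakDeriv a b f g := ⟨g, hg⟩
  rw [weakDeriv, dif_pos h]
  exact h.choose_spec

/-- The chosen representative is a priori only locally integrable; it inherits integrability from
the square integrable one by almost everywhere uniqueness. -/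
theorem MemH1.intervalIntegrable_weakDeriv {a b : ℝ} (hab : a ≤ b) {f : ℝ → ℝ}
    (hf : MemH1 a b f) : IntervalIntegrable (weakDeriv a b f) volume a b := by
  have hw := hf.isWeakDeriv_weakDeriv
  obtain ⟨-, g, hg, hg2⟩ := hf
  rw [intervalIntegrable_iff_integrableOn_Ioo_of_le hab]
  exact (hg2.integrable (by norm_num)).congr (hg.ae_eq hw)

theorem lemma2p1 (B : ℝ → ℝ) (hB : IsNormalization B) (a b : ℝ) (hab : a < b)
    (α : ℝ) (hα0 : 0 < α) (hα1 : α < 1)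
    -- `f` is the continuous representative on `[a, b]` of an element of `H¹(a, b)`
    (f : ℝ → ℝ) (hf : MemH1 a b f) (hfc : ContinuousOn f (Icc a b))
    (t₀ : ℝ) (ht₀ : t₀ ∈ Icc a b) (hmax : IsMaxOn f (Icc a b) t₀) :
    -- the integral defining the ABC derivative at `t₀` converges absolutely
    IntervalIntegrable (abcIntegrand α a b f t₀) volume a t₀ ∧
    B α / (1 - α) * mittagLeffler α (-(α / (1 - α)) * (t₀ - a) ^ α) * (f t₀ - f a)
      ≤ abcDeriv B α a b f t₀ ∧
    0 ≤ B α / (1 - α) * mittagLeffler α (-(α / (1 - α)) * (t₀ - a) ^ α) * (f t₀ - f a) := by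
  have hlam : 0 < α / (1 - α) := div_pos hα0 (by linarith)
  have hBα : 0 < B α / (1 - α) := div_pos (hB.pos α ⟨hα0.le, hα1.le⟩) (by linarith)
  have hgab := hf.intervalIntegrable_weakDeriv hab.le
  have hg : IntervalIntegrable (weakDeriv a b f) volume a t₀ := hgab.mono_set (by
    rw [uIcc_of_le hab.le, uIcc_of_le ht₀.1]
    exact Icc_subset_Icc_right ht₀.2)
  have hFTC : ∀ c ∈ Icc a t₀, ∫ s in c..t₀, weakDeriv a b f s = f t₀ - f c := fun c hc =>
    hf.isWeakDeriv_weakDeriv.integral_eq_sub hab hfc hgab ⟨hc.1, hc.2.trans ht₀.2⟩ ht₀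
  set h : ℝ → ℝ := fun s => mittagLeffler α (-(α / (1 - α)) * (t₀ - s) ^ α) with hh
  have hhc : Continuous h :=
    (continuous_mittagLeffler_neg_rpow hα0 (α / (1 - α))).comp (continuous_const.sub continuous_id)
  have hhm : StrictMonoOn h (Icc a t₀) := fun x hx y hy hxy =>
    mittagLeffler_neg_rpow_strictAntiOn hα0 hα1 hlam (sub_nonneg.2 hy.2) (sub_nonneg.2 hx.2)
      (sub_lt_sub_left hxy t₀)
  have ha : a ∈ Icc a t₀ := left_mem_Icc.2 ht₀.1
  refine ⟨hg.continuousOn_mul hhc.continuousOn, ?_, ?_⟩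
  · have key := mul_integral_le_integral_mul_of_strictMonoOn ht₀.1 hhc hhm hg fun c hc => by
      rw [hFTC c hc]
      exact sub_nonneg.2 (hmax ⟨hc.1, hc.2.trans ht₀.2⟩)
    rw [hFTC a ha] at key
    rw [mul_assoc]
    exact mul_le_mul_of_nonneg_left key hBα.le
  · exact mul_nonneg (mul_pos hBα (mittagLeffler_neg_rpow_pos hα0 hα1 hlam.le
      (sub_nonneg.2 ht₀.1))).le (sub_nonneg.2 (hmax (left_mem_Icc.2 hab.le)))
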